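/- Let $\mathbf K$ be $\mathbb R$, $\mathbb C$ or the quaternions $\mathbb H$, and let $\delta = 1, 2, 4$, respectively, be its real dimension. Regard $\mathbf K^m$ as a right $\mathbf K$-linear space, and let $\ell_{p;\mathbf K}^m$ be $\mathbf K^m$ with the norm $\|x\|_p = \bigl(\sum_{i=1}^m |\xi_i|^p\bigr)^{1/p}$, $x = (\xi_i)_{i=1}^m$. For an integer $m \ge 1$ and an even integer $p \ge 2$, let $N_{\mathbf K}(m,p)$ be the minimal $n$ such that there is an isometric embedding, i.e. a norm-preserving right $\mathbf K$-linear map, $\ell_{2;\mathbf K}^m \to \ell_{p;\mathbf K}^n$. Such $n$ exist, so that $N_{\mathbf K}(m,p)$ is well defined, and for all integers $m \ge 2$ and all even $p \ge 4$ $$ N_{\mathbf K}(m,p) \le \begin{cases} N_{\mathbb R}(\delta,\, p/2-1)\,(p/2+1)\,N_{\mathbf K}(m-1,p), & p \equiv 2 \pmod 4,\\ N_{\mathbb R}(\delta,\, p/2)\,\bigl((p/2)\,N_{\mathbf K}(m-1,p)+1\bigr), & p \equiv 0 \pmod 4. \end{cases} $$ -/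

import Mathlib

/-- The set of all `n` such that there is an isometric embedding of the `m`-dimensional space
`ℓ₂` over `K` into the `n`-dimensional space `ℓ_p` over `K`, where `Kᵐ` is regarded as a right
`K`-linear space (that is, a module over the opposite ring `Kᵐᵒᵖ`, acting coordinatewise by
`x ↦ x * α`). -/
def embeddingDims (K : Type) [NormedRing K] (m p : ℕ) : Set ℕ :=
  {n : ℕ | ∃ f : PiLp 2 (fun _ : Fin m => K) →ₗ[Kᵐᵒᵖ] PiLp (p : ENNReal) (fun _ : Fin n => K),
    ∀ x, ‖f x‖ = ‖x‖}

/-- `minDim K m p` is the minimal `n` such that there is an isometric embedding of the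
`m`-dimensional `ℓ₂` into the `n`-dimensional `ℓ_p`, over `K`. -/
noncomputable def minDim (K : Type) [NormedRing K] (m p : ℕ) : ℕ :=
  sInf (embeddingDims K m p)

/-! ### Embeddings as identities between sums of powers -/

open scoped RealInnerProductSpace

/-! With p = 2t, an embedding is an identity ∑ |c_k · y|^{2t} = |y|^{2t}, where nonnegative weights
may be allowed. Applying the Laplacian shows that such a system, with its vectors normalized, also
averages every lower even power correctly.

To pass from m to m + 1, split y = (ξ, y') and use the vectors (z u, v) with z real, u a unit of K
and v a unit vector of a system for m. With η = v · y', |z u ξ + η|² = z²|ξ|² + 2z⟨uξ, η⟩ + |η|². If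
the odd moments of z vanish, only even powers ⟨uξ, η⟩^{2i} with 2i ≤ t survive in the t-th power, so
a real system on K = ℝ^δ of degree 2⌊t/2⌋ suffices for u; hence the dependence on p mod 4.

After averaging over u and v, Chu–Vandermonde reduces the claim to the binomial theorem, provided
the 2r-th moment of z is proportional to (δ/2)_r (δm/2)_{t-r}. These are Beta integrals and form a
positive definite sequence. Gauss quadrature with t nodes (`exists_quadrature`) matches all moments
below 2t; the nonnegative defect in the top one is supplied by the vector (1, 0), a node at
infinity. So t·N·n + 1 vectors suffice (`succ_mem_embeddingDims`), and N, n ≥ 1 turns this into both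
bounds. -/

theorem embeddingDims_iff {K : Type} [NormedDivisionRing K] {m t n : ℕ} (ht : 0 < t) :
    n ∈ embeddingDims K m (2 * t) ↔ ∃ c : Fin n → Fin m → K, ∀ y : Fin m → K,
      ∑ k, (‖∑ i, c k i * y i‖ ^ 2) ^ t = (∑ i, ‖y i‖ ^ 2) ^ t := by
  have hp : 0 < ((2 * t : ℕ) : ENNReal).toReal := by
    rw [ENNReal.toReal_natCast]; positivity
  have key : ∀ (x : PiLp 2 (fun _ : Fin m => K)) (y : PiLp ((2 * t : ℕ) : ENNReal)
      (fun _ : Fin n => K)),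
      ‖y‖ = ‖x‖ ↔ ∑ k, (‖y k‖ ^ 2) ^ t = (∑ i, ‖x i‖ ^ 2) ^ t := by
    intro x y
    have h1 : ‖y‖ ^ (2 * t) = ∑ k, (‖y k‖ ^ 2) ^ t := by
      rw [PiLp.norm_eq_sum hp, ← Real.rpow_natCast, ← Real.rpow_mul (by positivity)]
      rw [ENNReal.toReal_natCast, one_div, inv_mul_cancel₀ (by positivity), Real.rpow_one]
      simp only [Real.rpow_natCast, pow_mul]
    have h2 : ‖x‖ ^ (2 * t) = (∑ i, ‖x i‖ ^ 2) ^ t := by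
      rw [pow_mul]
      congr 1
      rw [PiLp.norm_eq_sum (by norm_num), ← Real.rpow_natCast, ← Real.rpow_mul (by positivity)]
      norm_num
    rw [← h1, ← h2]
    have h0 : 0 ≤ ‖y‖ := by rw [PiLp.norm_eq_sum hp]; positivity
    exact (pow_left_inj₀ h0 (norm_nonneg x) (by positivity)).symm
  constructor
  · rintro ⟨f, hf⟩
    refine ⟨fun k i => f (WithLp.toLp 2 (Pi.single i 1)) k, fun y => ?_⟩
    rw [← (key (WithLp.toLp 2 y) _).1 (hf _)]
    refine Finset.sum_congr rfl fun k _ => ?_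
    have : (WithLp.toLp 2 y : PiLp 2 (fun _ : Fin m => K)) =
        ∑ i, MulOpposite.op (y i) • WithLp.toLp 2 (Pi.single i (1 : K)) := by
      ext j
      simp [Pi.single_apply]
    rw [this, map_sum]
    simp
  · rintro ⟨c, hc⟩
    refine ⟨{ toFun := fun x => WithLp.toLp _ fun k => ∑ i, c k i * x i
              map_add' := fun x y => ?_
              map_smul' := fun a x => ?_ }, fun x => ?_⟩
    · ext k; simp [mul_add, Finset.sum_add_distrib]
    · ext k; simp [Finset.sum_mul, mul_assoc]
    · rw [key]
      exact hc _

theorem pos_of_mem_embeddingDims {K : Type} [NormedDivisionRing K] {m t n : ℕ} (ht : 0 < t)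
    (hm : 0 < m) (h : n ∈ embeddingDims K m (2 * t)) : 0 < n := by
  obtain ⟨c, hc⟩ := (embeddingDims_iff ht).1 h
  rcases Nat.eq_zero_or_pos n with rfl | hn
  · have := hc (fun _ => 1)
    simp only [Finset.univ_eq_empty, Finset.sum_empty, norm_one, one_pow, Finset.sum_const,
      Finset.card_univ, Fintype.card_fin, nsmul_eq_mul, mul_one] at this
    exact absurd this (by positivity)
  · exact hn

theorem one_mem_embeddingDims {K : Type} [NormedDivisionRing K] {t : ℕ} (ht : 0 < t) :
    1 ∈ embeddingDims K 1 (2 * t) :=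
  (embeddingDims_iff ht).2 ⟨fun _ _ => 1, fun y => by simp⟩

theorem self_mem_embeddingDims {K : Type} [NormedDivisionRing K] {m : ℕ} :
    m ∈ embeddingDims K m 2 :=
  (embeddingDims_iff one_pos).2 ⟨fun k => Pi.single k 1, fun y => by simp [Pi.single_apply]⟩

/-- Positive weights can be absorbed into the vectors of a weighted representation of
`(∑ ‖y i‖ ^ 2) ^ t`. -/
theorem card_mem_embeddingDims {K : Type} [NormedDivisionRing K] [InnerProductSpace ℝ K]
    [IsScalarTower ℝ K K] {ι : Type*} [Fintype ι] {m t : ℕ} (ht : 0 < t)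
    (w : ι → ℝ) (hw : ∀ k, 0 ≤ w k) (c : ι → Fin m → K) {A : ℝ} (hA : 0 < A)
    (h : ∀ y : Fin m → K, ∑ k, w k * (‖∑ i, c k i * y i‖ ^ 2) ^ t = A * (∑ i, ‖y i‖ ^ 2) ^ t) :
    Fintype.card ι ∈ embeddingDims K m (2 * t) := by
  refine (embeddingDims_iff ht).2
    ⟨fun k i => ((w ((Fintype.equivFin ι).symm k) / A) ^ (((2 * t : ℕ) : ℝ)⁻¹) : ℝ) •
      c ((Fintype.equivFin ι).symm k) i, fun y => ?_⟩
  rw [Equiv.sum_comp (Fintype.equivFin ι).symm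
    (fun k => (‖∑ i, ((w k / A) ^ (((2 * t : ℕ) : ℝ)⁻¹) : ℝ) • c k i * y i‖ ^ 2) ^ t)]
  have : ∀ k, (‖∑ i, ((w k / A) ^ (((2 * t : ℕ) : ℝ)⁻¹) : ℝ) • c k i * y i‖ ^ 2) ^ t
      = A⁻¹ * (w k * (‖∑ i, c k i * y i‖ ^ 2) ^ t) := by
    intro k
    have h0 : 0 ≤ w k / A := div_nonneg (hw k) hA.le
    simp_rw [smul_mul_assoc]
    rw [← Finset.smul_sum, norm_smul, Real.norm_of_nonneg (by positivity), mul_pow, mul_pow,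
      ← pow_mul, Real.rpow_inv_natCast_pow h0 (by positivity)]
    ring
  simp_rw [this]
  rw [← Finset.mul_sum, h, inv_mul_cancel_left₀ hA.ne']

/-! ### Multiplication and the inner product -/

/-- Multiplication by `c` is a similarity because the norm is multiplicative; polarization does the
rest. No conjugation is needed, so the three fields are treated at once. -/
theorem real_inner_mul_mul_right {K : Type} [NormedDivisionRing K] [InnerProductSpace ℝ K]
    (a b c : K) : ⟪a * c, b * c⟫ = ‖c‖ ^ 2 * ⟪a, b⟫ := by
  rw [real_inner_eq_norm_add_mul_self_sub_norm_mul_self_sub_norm_mul_self_div_two,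
    real_inner_eq_norm_add_mul_self_sub_norm_mul_self_sub_norm_mul_self_div_two, ← add_mul,
    norm_mul, norm_mul, norm_mul]
  ring

theorem real_inner_mul_mul_left {K : Type} [NormedDivisionRing K] [InnerProductSpace ℝ K]
    (a b c : K) : ⟪c * a, c * b⟫ = ‖c‖ ^ 2 * ⟪a, b⟫ := by
  rw [real_inner_eq_norm_add_mul_self_sub_norm_mul_self_sub_norm_mul_self_div_two,
    real_inner_eq_norm_add_mul_self_sub_norm_mul_self_sub_norm_mul_self_div_two, ← mul_add,
    norm_mul, norm_mul, norm_mul]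
  ring

theorem OrthonormalBasis.sum_sq_inner_mul {K : Type} [NormedDivisionRing K]
    [InnerProductSpace ℝ K] {κ : Type*} [Fintype κ] (b : OrthonormalBasis κ ℝ K) (f c : K) :
    ∑ l, ⟪f, c * b l⟫ ^ 2 = ‖c‖ ^ 2 * ‖f‖ ^ 2 := by
  rcases eq_or_ne c 0 with rfl | hc
  · simp
  have h : ∀ l, ⟪f, c * b l⟫ = ‖c‖ ^ 2 * ⟪c⁻¹ * f, b l⟫ := fun l => by
    rw [← real_inner_mul_mul_left, mul_inv_cancel_left₀ hc]
  simp_rw [h, mul_pow]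
  rw [← Finset.mul_sum, b.sum_sq_inner_left, norm_mul, norm_inv]
  have : ‖c‖ ≠ 0 := norm_ne_zero_iff.2 hc
  field_simp

/-! ### Descent by the Laplacian -/

/-- Comparison of the second order coefficients in an identity between powers of quadratic
polynomials. -/
theorem sum_second_coeff_eq {ι : Type*} [Fintype ι] (w a b c : ι → ℝ) (C a' b' c' : ℝ) (j : ℕ)
    (h : ∀ ε : ℝ, ∑ k, w k * (a k + 2 * ε * b k + ε ^ 2 * c k) ^ (j + 1) =
      C * (a' + 2 * ε * b' + ε ^ 2 * c') ^ (j + 1)) :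
    ∑ k, w k * (a k ^ j * c k + 2 * j * (a k ^ (j - 1) * b k ^ 2)) =
      C * (a' ^ j * c' + 2 * j * (a' ^ (j - 1) * b' ^ 2)) := by
  let P : ℝ → ℝ → ℝ → Polynomial ℝ := fun a b c =>
    (Polynomial.C a + 2 * Polynomial.X * Polynomial.C b + Polynomial.X ^ 2 * Polynomial.C c) ^
      (j + 1)
  have hP : ∀ a b c, (Polynomial.derivative (Polynomial.derivative (P a b c))).eval 0 =
      2 * (j + 1) * (a ^ j * c + 2 * j * (a ^ (j - 1) * b ^ 2)) := by
    intro a b c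
    simp only [P, Polynomial.derivative_pow_succ, Polynomial.derivative_mul,
      Polynomial.derivative_add, Polynomial.derivative_C, Polynomial.derivative_X,
      Polynomial.derivative_pow, Polynomial.derivative_ofNat]
    simp
    ring
  have hpoly : ∑ k, Polynomial.C (w k) * P (a k) (b k) (c k) = Polynomial.C C * P a' b' c' := by
    refine Polynomial.funext fun ε => ?_
    simp only [P, Polynomial.eval_finsetSum, Polynomial.eval_mul, Polynomial.eval_pow,
      Polynomial.eval_add, Polynomial.eval_C, Polynomial.eval_X, Polynomial.eval_ofNat]
    exact h ε
  have h2 := congrArg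
    (fun p => (Polynomial.derivative (Polynomial.derivative p)).eval 0) hpoly
  simp only [Polynomial.derivative_sum, Polynomial.derivative_C_mul, Polynomial.eval_finsetSum,
    Polynomial.eval_mul, Polynomial.eval_C, hP] at h2
  have h3 : (2 * ((j : ℝ) + 1)) ≠ 0 := by positivity
  refine mul_left_cancel₀ h3 ?_
  rw [Finset.mul_sum]
  convert h2 using 1
  · exact Finset.sum_congr rfl fun _ _ => by ring
  · ring

section Descent

variable {K : Type} [NormedDivisionRing K] [InnerProductSpace ℝ K] [SMulCommClass ℝ K K]
  [FiniteDimensional ℝ K]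

/-- The effect of the Laplace operator on a weighted representation of `(∑ ‖y i‖ ^ 2) ^ (j + 1)`. -/
theorem sum_weight_mul_pow_descend {ι : Type*} [Fintype ι] {m j : ℕ} (w : ι → ℝ)
    (c : ι → Fin m → K) {C : ℝ}
    (h : ∀ y : Fin m → K,
      ∑ k, w k * (‖∑ i, c k i * y i‖ ^ 2) ^ (j + 1) = C * (∑ i, ‖y i‖ ^ 2) ^ (j + 1))
    (y : Fin m → K) :
    (Module.finrank ℝ K + 2 * j) * ∑ k, w k * ((∑ i, ‖c k i‖ ^ 2) * (‖∑ i, c k i * y i‖ ^ 2) ^ j) =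
      C * (Module.finrank ℝ K * m + 2 * j) * (∑ i, ‖y i‖ ^ 2) ^ j := by
  let b := stdOrthonormalBasis ℝ K
  have hb : ∀ l, ‖b l‖ = 1 := fun l => b.orthonormal.1 l
  -- Perturb coordinate `i` in direction `b l` and compare ε² coefficients; summing over `i` and `l`
  -- gives the Laplacian on K^m as a real space.
  have key : ∀ i l, _ := fun i l => sum_second_coeff_eq w
    (fun k => ‖∑ i, c k i * y i‖ ^ 2) (fun k => ⟪∑ i, c k i * y i, c k i * b l⟫)
    (fun k => ‖c k i‖ ^ 2) C (∑ i, ‖y i‖ ^ 2) ⟪y i, b l⟫ 1 j (fun ε => by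
      convert h (y + Pi.single i (ε • b l)) using 3 with k
      · congr 1
        have : ∑ i', c k i' * (y + Pi.single i (ε • b l) : Fin m → K) i' =
            ∑ i', c k i' * y i' + ε • (c k i * b l) := by
          simp [mul_add, Finset.sum_add_distrib, Pi.single_apply, mul_smul_comm]
        rw [this, norm_add_sq_real, inner_smul_right, norm_smul, norm_mul, hb, mul_pow,
          Real.norm_eq_abs, sq_abs]
        ring
      · have : ∀ i', ‖(y + Pi.single i (ε • b l) : Fin m → K) i'‖ ^ 2 = ‖y i'‖ ^ 2 +
            if i' = i then 2 * ε * ⟪y i, b l⟫ + ε ^ 2 else 0 := by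
          intro i'
          rcases eq_or_ne i' i with rfl | hi
          · simp only [Pi.add_apply, Pi.single_eq_same, if_true]
            rw [norm_add_sq_real, inner_smul_right, norm_smul, hb, mul_pow,
              Real.norm_eq_abs, sq_abs]
            ring
          · simp [hi]
        simp_rw [this]
        rw [Finset.sum_add_distrib, Finset.sum_ite_eq' Finset.univ i]
        simp
        ring)
  have hsum := Finset.sum_congr (rfl : (Finset.univ : Finset (Fin m)) = _) fun i _ =>
    Finset.sum_congr (rfl : (Finset.univ : Finset (Fin (Module.finrank ℝ K))) = _) fun l _ =>
      key i l
  -- The truncated exponent at `j = 0` is harmless, since the factor `j` kills the term.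
  have hj : ∀ x : ℝ, (j : ℝ) * (x ^ (j - 1) * x) = j * x ^ j := by
    intro x
    rcases j with _ | j
    · simp
    · simp [pow_succ]
  have hL : ∑ i : Fin m, ∑ l : Fin (Module.finrank ℝ K),
      ∑ k, w k * ((‖∑ i, c k i * y i‖ ^ 2) ^ j * ‖c k i‖ ^ 2 +
        2 * j * ((‖∑ i, c k i * y i‖ ^ 2) ^ (j - 1) * ⟪∑ i, c k i * y i, c k i * b l⟫ ^ 2)) =
      (Module.finrank ℝ K + 2 * j) *
        ∑ k, w k * ((∑ i, ‖c k i‖ ^ 2) * (‖∑ i, c k i * y i‖ ^ 2) ^ j) := by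
    rw [Finset.mul_sum]
    simp_rw [fun i => Finset.sum_comm (s := (Finset.univ : Finset (Fin (Module.finrank ℝ K))))
      (t := (Finset.univ : Finset ι)) (f := fun l k => w k * ((‖∑ i, c k i * y i‖ ^ 2) ^ j *
        ‖c k i‖ ^ 2 + 2 * j * ((‖∑ i, c k i * y i‖ ^ 2) ^ (j - 1) *
          ⟪∑ i, c k i * y i, c k i * b l⟫ ^ 2)))]
    rw [Finset.sum_comm]
    refine Finset.sum_congr rfl fun k _ => ?_
    simp_rw [← Finset.mul_sum, Finset.sum_add_distrib, ← Finset.mul_sum, b.sum_sq_inner_mul]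
    simp only [Finset.sum_const, Finset.card_univ, Fintype.card_fin, nsmul_eq_mul]
    rw [← Finset.mul_sum, ← Finset.sum_mul]
    linear_combination 2 * w k * (∑ i, ‖c k i‖ ^ 2) * hj (‖∑ i, c k i * y i‖ ^ 2)
  rw [← hL, hsum]
  simp_rw [← Finset.mul_sum, Finset.sum_add_distrib, ← Finset.mul_sum, b.sum_sq_inner_left]
  simp only [Finset.sum_const, Finset.card_univ, Fintype.card_fin, nsmul_eq_mul]
  linear_combination 2 * C * hj (∑ i, ‖y i‖ ^ 2)

end Descent

/-! ### Rising factorials -/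

/-- The rising factorial `a * (a + 1) * ⋯ * (a + n - 1)`. -/
def risingFactorial (a : ℝ) (n : ℕ) : ℝ := ∏ i ∈ Finset.range n, (a + i)

theorem risingFactorial_zero (a : ℝ) : risingFactorial a 0 = 1 := by simp [risingFactorial]

theorem risingFactorial_succ (a : ℝ) (n : ℕ) :
    risingFactorial a (n + 1) = risingFactorial a n * (a + n) :=
  Finset.prod_range_succ _ _

theorem risingFactorial_pos {a : ℝ} (ha : 0 < a) (n : ℕ) : 0 < risingFactorial a n :=
  Finset.prod_pos fun _ _ => by positivity

theorem risingFactorial_add (a : ℝ) (m n : ℕ) :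
    risingFactorial a (m + n) = risingFactorial a m * risingFactorial (a + m) n := by
  simp only [risingFactorial, Finset.prod_range_add, Nat.cast_add, add_assoc]

theorem risingFactorial_succ' (a : ℝ) (n : ℕ) :
    risingFactorial a (n + 1) = a * risingFactorial (a + 1) n := by
  rw [add_comm n 1, risingFactorial_add]
  simp [risingFactorial]

theorem four_pow_mul_risingFactorial_half (n : ℕ) :
    4 ^ n * risingFactorial (1 / 2) n * n.factorial = (2 * n).factorial := by
  induction n with
  | zero => simp [risingFactorial]
  | succ n ih =>
    rw [show 2 * (n + 1) = 2 * n + 1 + 1 by ring, Nat.factorial_succ, Nat.factorial_succ,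
      Nat.factorial_succ, risingFactorial_succ]
    push_cast
    rw [← ih]
    ring

/-- The Chu–Vandermonde identity. -/
theorem sum_choose_mul_descFactorial_mul_risingFactorial (r s : ℕ) (a : ℝ) :
    ∑ i ∈ Finset.range (r + 1), (r.choose i : ℝ) * s.descFactorial i *
      risingFactorial (a + i) (r - i) = risingFactorial (a + s) r := by
  induction s generalizing r a with
  | zero =>
    rw [Finset.sum_eq_single_of_mem 0 (by simp)]
    · simp
    · intro i _ hi
      obtain ⟨i, rfl⟩ := Nat.exists_eq_succ_of_ne_zero hi
      simp
  | succ s ih =>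
    rcases r with _ | r
    · simp [risingFactorial]
    have hdesc : ∀ i, ((s + 1).descFactorial (i + 1) : ℝ) =
        s.descFactorial (i + 1) + (i + 1) * s.descFactorial i := by
      intro i
      rw [Nat.succ_descFactorial_succ]
      rcases le_or_gt i s with h | h
      · rw [Nat.descFactorial_succ]
        push_cast [h]
        ring
      · rw [Nat.descFactorial_of_lt h, Nat.descFactorial_of_lt (h.trans (Nat.lt_succ_self i))]
        simp
    have hchoose : ∀ i, ((r + 1).choose (i + 1) : ℝ) * (i + 1) = (r + 1) * r.choose i := by
      intro i
      exact_mod_cast (Nat.add_one_mul_choose_eq r i).symm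
    have h1 : ∑ i ∈ Finset.range (r + 1 + 1), ((r + 1).choose i : ℝ) * (s + 1).descFactorial i *
        risingFactorial (a + i) (r + 1 - i) =
        ∑ i ∈ Finset.range (r + 1 + 1), ((r + 1).choose i : ℝ) * s.descFactorial i *
          risingFactorial (a + i) (r + 1 - i) +
        (r + 1) * ∑ i ∈ Finset.range (r + 1), (r.choose i : ℝ) * s.descFactorial i *
          risingFactorial (a + 1 + i) (r - i) := by
      rw [Finset.sum_range_succ' _ (r + 1), Finset.sum_range_succ' _ (r + 1), Finset.mul_sum,
        add_right_comm, ← Finset.sum_add_distrib]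
      congr 1
      refine Finset.sum_congr rfl fun i _ => ?_
      rw [hdesc, Nat.add_sub_add_right]
      push_cast
      rw [show a + (i + 1 : ℝ) = a + 1 + i by ring]
      linear_combination (s.descFactorial i : ℝ) * risingFactorial (a + 1 + i) (r - i) *
        hchoose i
    rw [h1, ih, ih, risingFactorial_succ', Nat.cast_succ,
      show a + 1 + (s : ℝ) = a + s + 1 by ring, show a + ((s : ℝ) + 1) = a + s + 1 by ring,
      risingFactorial_succ]
    ring

/-! ### Unit systems exact in all lower degrees -/

section Normalize

variable {K : Type} [NormedDivisionRing K] [InnerProductSpace ℝ K] [FiniteDimensional ℝ K]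

/-- Each descent from `j + 1` to `j` contributes a factor (b + j)/(a + j); these telescope into the
quotient of rising factorials. -/
theorem sum_norm_pow_mul_pow_eq [SMulCommClass ℝ K K] {ι : Type*} [Fintype ι] {m t : ℕ} (hm : 0 < m)
    (c : ι → Fin m → K)
    (h : ∀ y : Fin m → K, ∑ k, (‖∑ i, c k i * y i‖ ^ 2) ^ t = (∑ i, ‖y i‖ ^ 2) ^ t)
    {a b : ℝ} (ha : a = (Module.finrank ℝ K : ℝ) / 2) (hb : b = (Module.finrank ℝ K * m : ℝ) / 2)
    (d j : ℕ) (hd : d + j = t) (y : Fin m → K) :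
    ∑ k, (∑ i, ‖c k i‖ ^ 2) ^ d * (‖∑ i, c k i * y i‖ ^ 2) ^ j =
      risingFactorial b t / risingFactorial a t * (risingFactorial a j / risingFactorial b j) *
        (∑ i, ‖y i‖ ^ 2) ^ j := by
  have hK : (0 : ℝ) < Module.finrank ℝ K := by exact_mod_cast Module.finrank_pos
  have ha0 : 0 < a := by rw [ha]; positivity
  have hb0 : 0 < b := by rw [hb]; positivity
  induction d generalizing j y with
  | zero =>
    have hj : j = t := by omega
    subst hj
    have h1 := (risingFactorial_pos ha0 j).ne'
    have h2 := (risingFactorial_pos hb0 j).ne'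
    simp only [pow_zero, one_mul, h y]
    field_simp
  | succ d ih =>
    have h1 := (risingFactorial_pos ha0 j).ne'
    have h2 := (risingFactorial_pos hb0 j).ne'
    have h3 := sum_weight_mul_pow_descend _ c (ih (j + 1) (by omega)) y
    have h4 : (Module.finrank ℝ K + 2 * j : ℝ) = 2 * (a + j) := by rw [ha]; ring
    have h5 : (Module.finrank ℝ K * m + 2 * j : ℝ) = 2 * (b + j) := by rw [hb]; ring
    rw [h4, h5, risingFactorial_succ, risingFactorial_succ] at h3
    have h6 : a + j ≠ 0 := by positivity
    have h7 : b + j ≠ 0 := by positivity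
    refine mul_left_cancel₀ (mul_ne_zero two_ne_zero h6) ?_
    convert h3 using 1
    · congr 1
      exact Finset.sum_congr rfl fun _ _ => by ring
    · field_simp

theorem exists_normalized_weights [SMulCommClass ℝ K K] [IsScalarTower ℝ K K]
    {ι : Type*} [Fintype ι] {m t : ℕ} (hm : 0 < m) (ht : 0 < t)
    (c : ι → Fin m → K)
    (h : ∀ y : Fin m → K, ∑ k, (‖∑ i, c k i * y i‖ ^ 2) ^ t = (∑ i, ‖y i‖ ^ 2) ^ t)
    {a b : ℝ} (ha : a = (Module.finrank ℝ K : ℝ) / 2)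
    (hb : b = (Module.finrank ℝ K * m : ℝ) / 2) :
    ∃ (w : ι → ℝ) (v : ι → Fin m → K) (A : ℝ), (∀ k, 0 ≤ w k) ∧ (∀ k, ∑ i, ‖v k i‖ ^ 2 = 1) ∧
      0 < A ∧ ∀ j ≤ t, ∀ y : Fin m → K, ∑ k, w k * (‖∑ i, v k i * y i‖ ^ 2) ^ j =
        A * (risingFactorial a j / risingFactorial b j) * (∑ i, ‖y i‖ ^ 2) ^ j := by
  classical
  have hK : (0 : ℝ) < Module.finrank ℝ K := by exact_mod_cast Module.finrank_pos
  have ha0 : 0 < a := by rw [ha]; positivity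
  have hb0 : 0 < b := by rw [hb]; positivity
  let N : ι → ℝ := fun k => ∑ i, ‖c k i‖ ^ 2
  have hN : ∀ k, 0 ≤ N k := fun k => Finset.sum_nonneg fun _ _ => by positivity
  -- A zero vector cannot be normalized, but its weight is 0 because `t > 0`, so any unit vector may
  -- replace it.
  refine ⟨fun k => N k ^ t, fun k => if N k = 0 then Pi.single ⟨0, hm⟩ 1 else
    fun i => ((√(N k))⁻¹ : ℝ) • c k i, risingFactorial b t / risingFactorial a t,
    fun k => pow_nonneg (hN k) _, fun k => ?_,
    div_pos (risingFactorial_pos hb0 t) (risingFactorial_pos ha0 t), fun j hj y => ?_⟩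
  · dsimp only
    split_ifs with h0
    · rw [Finset.sum_eq_single_of_mem ⟨0, hm⟩ (Finset.mem_univ _)]
      · simp
      · intro i _ hi
        simp [hi]
    · simp only [norm_smul, mul_pow, norm_inv, Real.norm_eq_abs, inv_pow, sq_abs]
      rw [← Finset.mul_sum, Real.sq_sqrt (hN k)]
      exact inv_mul_cancel₀ h0
  · rw [← sum_norm_pow_mul_pow_eq hm c h ha hb (t - j) j (by omega)]
    refine Finset.sum_congr rfl fun k _ => ?_
    change N k ^ t * _ = N k ^ (t - j) * _
    dsimp only
    split_ifs with h0
    · have hc : ∀ i, c k i = 0 := by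
        intro i
        have := (Finset.sum_eq_zero_iff_of_nonneg (fun i _ => by positivity)).1 h0 i
          (Finset.mem_univ _)
        simpa using this
      rcases j with _ | j
      · simp
      · simp [h0, ht.ne', hc]
    · simp only [smul_mul_assoc]
      rw [← Finset.smul_sum, norm_smul, mul_pow, mul_pow, norm_inv, Real.norm_eq_abs, inv_pow,
        sq_abs, Real.sq_sqrt (hN k), ← Nat.sub_add_cancel hj, pow_add, Nat.sub_add_cancel hj,
        inv_pow]
      field_simp

/-- A real representation of `(∑ x i ^ 2) ^ t`, as a weighted system of unit vectors of `K`. -/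
theorem exists_unit_weights {δ n t : ℕ} (hδ : Module.finrank ℝ K = δ) (ht : 0 < t)
    (h : n ∈ embeddingDims ℝ δ (2 * t)) {a : ℝ} (ha : a = (δ : ℝ) / 2) :
    ∃ (w : Fin n → ℝ) (u : Fin n → K) (A : ℝ), (∀ k, 0 ≤ w k) ∧ (∀ k, ‖u k‖ = 1) ∧
      0 < A ∧ ∀ j ≤ t, ∀ x : K, ∑ k, w k * (⟪u k, x⟫ ^ 2) ^ j =
        A * (risingFactorial (1 / 2) j / risingFactorial a j) * (‖x‖ ^ 2) ^ j := by
  have hδ0 : 0 < δ := hδ ▸ Module.finrank_pos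
  obtain ⟨c, hc⟩ := (embeddingDims_iff ht).1 h
  obtain ⟨w, v, A, hw, hv, hA, hs⟩ := exists_normalized_weights (a := 1 / 2) (b := a) hδ0 ht c hc
    (by simp) (by simp [ha])
  let b := (stdOrthonormalBasis ℝ K).reindex (finCongr hδ)
  refine ⟨w, fun k => ∑ i, v k i • b i, A, hw, fun k => ?_, hA, fun j hj x => ?_⟩
  · have h1 : ‖∑ i, v k i • b i‖ ^ 2 = 1 := by
      rw [← hv k, ← real_inner_self_eq_norm_sq, b.orthonormal.inner_sum]
      simp [sq]
    exact (pow_eq_one_iff_of_nonneg (norm_nonneg _) two_ne_zero).1 h1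
  · have h2 := hs j hj (fun i => ⟪b i, x⟫)
    simp only [Real.norm_eq_abs, sq_abs] at h2
    rw [b.sum_sq_inner_right] at h2
    rw [← h2]
    simp [sum_inner, inner_smul_left]

end Normalize

/-! ### Gauss quadrature from a Hankel form -/

/-- A positive definite Hankel matrix is the Gram matrix of linearly independent vectors. -/
theorem exists_gram_vectors {n : ℕ} (M : ℕ → ℝ)
    (hM : ∀ c : Fin n → ℝ, c ≠ 0 → 0 < ∑ a, ∑ b, c a * c b * M (a + b)) :
    ∃ h : Fin n → EuclideanSpace ℝ (Fin n), LinearIndependent ℝ h ∧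
      ∀ a b, ⟪h a, h b⟫ = M (a + b) := by
  let G : Matrix (Fin n) (Fin n) ℝ := Matrix.of fun a b => M (a + b)
  have hG : G.PosDef := by
    rw [Matrix.posDef_iff_dotProduct_mulVec]
    refine ⟨Matrix.IsHermitian.ext fun a b => by simp [G, add_comm], fun x hx => ?_⟩
    refine (hM x hx).trans_eq ?_
    simp only [dotProduct, Matrix.mulVec, Finset.mul_sum, G, Matrix.of_apply, star_trivial]
    exact Finset.sum_congr rfl fun _ _ => Finset.sum_congr rfl fun _ _ => by ring
  obtain ⟨B, hB⟩ : ∃ B : Matrix (Fin n) (Fin n) ℝ, G = B.conjTranspose * B := by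
    open scoped MatrixOrder Matrix.Norms.L2Operator in
    exact CStarAlgebra.nonneg_iff_eq_star_mul_self.mp hG.posSemidef.nonneg
  have hgram : ∀ a b, ⟪WithLp.toLp 2 (fun i => B i a), WithLp.toLp 2 (fun i => B i b)⟫ =
      M (a + b) := by
    intro a b
    have := congrFun (congrFun hB a) b
    simp only [G, Matrix.of_apply, Matrix.mul_apply, Matrix.conjTranspose_apply,
      star_trivial] at this
    rw [this]
    simp [PiLp.inner_apply, mul_comm]
  refine ⟨fun a => WithLp.toLp 2 fun i => B i a, ?_, hgram⟩
  rw [Fintype.linearIndependent_iff]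
  intro c hc
  by_contra! hne
  have h0 : c ≠ 0 := fun h => by simp [h] at hne
  refine (hM c h0).ne ?_
  have h1 : ⟪∑ a, c a • WithLp.toLp 2 (fun i => B i a), ∑ a, c a • WithLp.toLp 2 (fun i => B i a)⟫
      = 0 := by rw [hc, inner_zero_left]
  rw [← h1, sum_inner]
  refine Finset.sum_congr rfl fun a _ => ?_
  rw [inner_sum]
  refine Finset.sum_congr rfl fun b _ => ?_
  rw [inner_smul_left, inner_smul_right, hgram]
  simp
  ring

/-- Gauss quadrature with an additional node at infinity, for a positive definite moment
sequence. -/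
theorem exists_quadrature {t : ℕ} (ht : 0 < t) (M : ℕ → ℝ)
    (hM : ∀ c : Fin (t + 1) → ℝ, c ≠ 0 → 0 < ∑ a, ∑ b, c a * c b * M (a + b)) :
    ∃ (z μ : Fin t → ℝ) (s : ℝ), (∀ i, 0 ≤ μ i) ∧ 0 ≤ s ∧
      ∀ j ≤ 2 * t, ∑ i, μ i * z i ^ j + (if j = 2 * t then s else 0) = M j := by
  obtain ⟨h, hli, hgram⟩ := exists_gram_vectors M hM
  let V : Submodule ℝ (EuclideanSpace ℝ (Fin (t + 1))) :=
    Submodule.span ℝ (Set.range fun a : Fin t => h a.castSucc)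
  have hV : Module.finrank ℝ V = t := by
    exact (finrank_span_eq_card (hli.comp _ (Fin.castSucc_injective t))).trans
      (Fintype.card_fin t)
  have hmem : ∀ a : Fin t, h a.castSucc ∈ V := fun a => Submodule.subset_span ⟨a, rfl⟩
  let bas := basisOfLinearIndependentOfCardEqFinrank hli (by simp)
  -- The shift, playing multiplication by the variable. Its value on the last vector is irrelevant,
  -- as only `S` on `V` is used.
  let S : EuclideanSpace ℝ (Fin (t + 1)) →ₗ[ℝ] EuclideanSpace ℝ (Fin (t + 1)) :=
    bas.constr ℝ fun a => if ha : (a : ℕ) < t then h (Fin.succ ⟨a, ha⟩) else 0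
  have hS : ∀ a : Fin t, S (h a.castSucc) = h a.succ := by
    intro a
    have : h a.castSucc = bas a.castSucc := by simp [bas]
    rw [this, Module.Basis.constr_basis]
    simp
  -- The compressed shift is symmetric by the Hankel property; its eigenvalues are the nodes, and
  -- the squared coordinates of `h 0` in an eigenbasis are the weights.
  let T : V →ₗ[ℝ] V := V.orthogonalProjectionOnto.toLinearMap ∘ₗ S ∘ₗ V.subtype
  have hT : T.IsSymmetric := by
    have hinner : ∀ v w : V, ⟪T v, w⟫ = ⟪S v, (w : EuclideanSpace ℝ (Fin (t + 1)))⟫ := fun v w => by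
      rw [Submodule.coe_inner]
      exact Submodule.inner_orthogonalProjectionOnto_eq_of_mem_right w _
    intro v w
    rw [hinner, real_inner_comm (T w) v, hinner]
    obtain ⟨v, hv⟩ := v
    obtain ⟨w, hw⟩ := w
    dsimp only
    induction hv using Submodule.span_induction with
    | mem v hv =>
      induction hw using Submodule.span_induction with
      | mem w hw =>
        obtain ⟨a, rfl⟩ := hv
        obtain ⟨b, rfl⟩ := hw
        simp only [hS, hgram]
        simp
        congr 1
        ring
      | zero => simp
      | add w w' _ _ h1 h2 => simp only [map_add, inner_add_left, inner_add_right, h1, h2]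
      | smul r w _ h1 => simp only [map_smul, inner_smul_left, inner_smul_right, h1]; simp
    | zero => simp
    | add w w' _ _ h1 h2 => simp only [map_add, inner_add_left, inner_add_right, h1, h2]
    | smul r w _ h1 => simp only [map_smul, inner_smul_left, inner_smul_right, h1]; simp
  have hproj : ∀ a : Fin t, V.orthogonalProjectionOnto (h a.castSucc) = ⟨_, hmem a⟩ := fun a =>
    V.orthogonalProjectionOnto_mem_subspace_eq_self ⟨_, hmem a⟩
  let e := hT.eigenvectorBasis hV
  let z := hT.eigenvalues hV
  let one : V := ⟨h 0, hmem ⟨0, ht⟩⟩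
  have hTpow : ∀ a : Fin (t + 1), (T ^ (a : ℕ)) one = V.orthogonalProjectionOnto (h a) := by
    intro a
    induction a using Fin.induction with
    | zero =>
      simp only [Fin.val_zero, pow_zero, Module.End.one_apply]
      exact (hproj ⟨0, ht⟩).symm
    | succ a ih =>
      rw [Fin.val_succ, pow_succ', Module.End.mul_apply]
      rw [Fin.val_castSucc] at ih
      rw [ih]
      simp only [T, LinearMap.comp_apply, Submodule.subtype_apply]
      rw [hproj, hS]
      rfl
  have hcoef : ∀ (j : ℕ) (i : Fin t), ⟪e i, (T ^ j) one⟫ = z i ^ j * ⟪e i, one⟫ := by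
    intro j i
    induction j with
    | zero => simp
    | succ j ih =>
      rw [pow_succ', Module.End.mul_apply, ← hT, hT.apply_eigenvectorBasis hV, inner_smul_left]
      change z i * ⟪e i, _⟫ = _
      rw [ih]
      ring
  have hsum : ∀ a b : ℕ, ∑ i, ⟪e i, one⟫ ^ 2 * z i ^ (a + b) = ⟪(T ^ a) one, (T ^ b) one⟫ := by
    intro a b
    rw [← e.sum_inner_mul_inner]
    refine Finset.sum_congr rfl fun i _ => ?_
    rw [real_inner_comm (e i) ((T ^ a) one), hcoef, hcoef]
    ring
  -- Projecting `h t` to `V` can only lose length: the loss is the mass at infinity.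
  have hnorm : ‖V.orthogonalProjectionOnto (h (Fin.last t))‖ ^ 2 ≤ M (2 * t) := by
    have h1 : M (2 * t) = ‖h (Fin.last t)‖ ^ 2 := by
      rw [← real_inner_self_eq_norm_sq, hgram, Fin.val_last, two_mul]
    rw [h1]
    gcongr
    exact V.norm_orthogonalProjectionOnto_apply_le _
  refine ⟨z, fun i => ⟪e i, one⟫ ^ 2, M (2 * t) - ‖V.orthogonalProjectionOnto (h (Fin.last t))‖ ^ 2,
    fun i => sq_nonneg _, by linarith, fun j hj => ?_⟩
  split_ifs with hj2
  · have h1 := hTpow (Fin.last t)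
    rw [Fin.val_last] at h1
    rw [hj2, two_mul t, hsum, h1, real_inner_self_eq_norm_sq]
    ring
  -- For `j < 2t`, the smaller half `j / 2` is below `t`, so its vector lies in `V` and projecting
  -- the other one does not change the inner product.
  · have ha : (j + 1) / 2 < t + 1 := by omega
    have hb : j / 2 < t := by omega
    have hab : j = (j + 1) / 2 + j / 2 := by omega
    have h1 := hTpow ⟨(j + 1) / 2, ha⟩
    have h2 := hTpow (Fin.castSucc ⟨j / 2, hb⟩)
    have h3 := hgram ⟨(j + 1) / 2, ha⟩ (Fin.castSucc ⟨j / 2, hb⟩)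
    simp only [Fin.val_castSucc] at h1 h2 h3
    rw [← hab] at h3
    rw [add_zero]
    nth_rewrite 1 [hab]
    rw [hsum, h1, h2, ← h3, Submodule.coe_inner]
    rw [hproj]
    exact Submodule.inner_orthogonalProjectionOnto_eq_of_mem_right ⟨_, hmem _⟩ _

/-! ### Beta integrals as moments -/

/-- Integrate the derivative of cos^{p+1} sin^{q+1}; it vanishes at both endpoints. -/
theorem integral_cos_pow_mul_sin_pow_succ (p q : ℕ) :
    ((p : ℝ) + 1) * ∫ θ in (0 : ℝ)..Real.pi / 2, Real.cos θ ^ p * Real.sin θ ^ (q + 2) =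
      (q + 1) * ∫ θ in (0 : ℝ)..Real.pi / 2, Real.cos θ ^ (p + 2) * Real.sin θ ^ q := by
  have hd : ∀ θ : ℝ, HasDerivAt (fun θ => Real.cos θ ^ (p + 1) * Real.sin θ ^ (q + 1))
      (((q : ℝ) + 1) * (Real.cos θ ^ (p + 2) * Real.sin θ ^ q) -
        (p + 1) * (Real.cos θ ^ p * Real.sin θ ^ (q + 2))) θ := by
    intro θ
    refine (((Real.hasDerivAt_cos θ).fun_pow (p + 1)).fun_mul
      ((Real.hasDerivAt_sin θ).fun_pow (q + 1))).congr_deriv ?_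
    simp only [Nat.add_sub_cancel]
    push_cast
    ring
  have h := intervalIntegral.integral_eq_sub_of_hasDerivAt (a := 0) (b := Real.pi / 2)
    (fun θ _ => hd θ)
    (Continuous.intervalIntegrable (by fun_prop) _ _)
  rw [intervalIntegral.integral_sub (Continuous.intervalIntegrable (by fun_prop) _ _)
    (Continuous.intervalIntegrable (by fun_prop) _ _), intervalIntegral.integral_const_mul,
    intervalIntegral.integral_const_mul] at h
  simp at h
  linarith

theorem integral_cos_pow_mul_sin_pow_pos (p q : ℕ) :
    0 < ∫ θ in (0 : ℝ)..Real.pi / 2, Real.cos θ ^ p * Real.sin θ ^ q := by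
  refine intervalIntegral.intervalIntegral_pos_of_pos_on
    (Continuous.intervalIntegrable (by fun_prop) _ _)
    (fun θ hθ => ?_) (by positivity)
  have h1 := Real.cos_pos_of_mem_Ioo ⟨by linarith [hθ.1, Real.pi_pos], hθ.2⟩
  have h2 := Real.sin_pos_of_pos_of_lt_pi hθ.1 (by linarith [hθ.2, Real.pi_pos])
  positivity

theorem exists_integral_cos_pow_mul_sin_pow_eq (p q t : ℕ) :
    ∃ A : ℝ, 0 < A ∧ ∀ r u, r + u = t →
      ∫ θ in (0 : ℝ)..Real.pi / 2, Real.cos θ ^ (p + 2 * r) * Real.sin θ ^ (q + 2 * u) =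
        A * (risingFactorial (((p + 1 : ℕ) : ℝ) / 2) r *
          risingFactorial (((q + 1 : ℕ) : ℝ) / 2) u) := by
  have hq := risingFactorial_pos (a := ((q + 1 : ℕ) : ℝ) / 2) (by positivity) t
  refine ⟨(∫ θ in (0 : ℝ)..Real.pi / 2, Real.cos θ ^ p * Real.sin θ ^ (q + 2 * t)) /
    risingFactorial (((q + 1 : ℕ) : ℝ) / 2) t,
    div_pos (integral_cos_pow_mul_sin_pow_pos _ _) hq, fun r => ?_⟩
  induction r with
  | zero =>
    rintro u hu
    obtain rfl : u = t := by omega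
    rw [risingFactorial_zero]
    field_simp
    simp
  | succ r ih =>
    intro u hu
    have h1 := ih (u + 1) (by omega)
    have h2 := integral_cos_pow_mul_sin_pow_succ (p + 2 * r) (q + 2 * u)
    rw [show q + 2 * (u + 1) = q + 2 * u + 2 by ring] at h1
    rw [h1, risingFactorial_succ] at h2
    rw [show p + 2 * (r + 1) = p + 2 * r + 2 by ring, risingFactorial_succ]
    have h3 : ((q + 2 * u : ℕ) : ℝ) + 1 ≠ 0 := by positivity
    refine mul_left_cancel₀ h3 ?_
    rw [← h2]
    push_cast
    ring

/-- The moments of the distribution of `±‖x‖ / ‖y‖`, up to normalization by powers of `‖y‖`, for a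
random point `(x, y)` of the sphere in `ℝ ^ (p + 1) × ℝ ^ (q + 1)`. -/
theorem exists_moments (p q t : ℕ) :
    ∃ (M : ℕ → ℝ) (A : ℝ), 0 < A ∧ (∀ j, Odd j → M j = 0) ∧
      (∀ r ≤ t, M (2 * r) = A * (risingFactorial (((p + 1 : ℕ) : ℝ) / 2) r *
          risingFactorial (((q + 1 : ℕ) : ℝ) / 2) (t - r))) ∧
      ∀ c : Fin (t + 1) → ℝ, c ≠ 0 → 0 < ∑ a, ∑ b, c a * c b * M (a + b) := by
  obtain ⟨A, hA, hI⟩ := exists_integral_cos_pow_mul_sin_pow_eq p q t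
  -- Symmetrizing in ± cos θ kills the odd moments; the power of sin θ makes the integrand
  -- homogeneous, so the Hankel form integrates squares of a form of degree `t`.
  let g : ℕ → ℝ → ℝ := fun j θ => Real.cos θ ^ p * Real.sin θ ^ q *
    ((Real.cos θ ^ j + (-Real.cos θ) ^ j) / 2 * Real.sin θ ^ (2 * t - j))
  have hg : ∀ j, Continuous (g j) := fun j => by fun_prop
  refine ⟨fun j => ∫ θ in (0 : ℝ)..Real.pi / 2, g j θ, A, hA, fun j hj => ?_, fun r hr => ?_,
    fun c hc => ?_⟩
  · simp [g, hj.neg_pow]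
  · rw [← hI r (t - r) (by omega)]
    refine intervalIntegral.integral_congr fun θ _ => ?_
    simp only [g]
    rw [(even_two_mul r).neg_pow, ← Nat.mul_sub]
    ring
  · let f : ℝ → ℝ → ℝ := fun x y => ∑ a : Fin (t + 1), c a * (x ^ (a : ℕ) * y ^ (t - a))
    have hf : ∀ x y, f x y ^ 2 = ∑ a : Fin (t + 1), ∑ b : Fin (t + 1), c a * c b *
        (x ^ (a + b : ℕ) * y ^ (2 * t - (a + b))) := by
      intro x y
      rw [sq, Finset.sum_mul_sum]
      refine Finset.sum_congr rfl fun a _ => Finset.sum_congr rfl fun b _ => ?_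
      rw [show 2 * t - (a + b : ℕ) = (t - a) + (t - b) by omega]
      ring
    have hsum : ∑ a : Fin (t + 1), ∑ b : Fin (t + 1),
        c a * c b * ∫ θ in (0 : ℝ)..Real.pi / 2, g (a + b) θ =
        ∫ θ in (0 : ℝ)..Real.pi / 2, Real.cos θ ^ p * Real.sin θ ^ q *
          ((f (Real.cos θ) (Real.sin θ) ^ 2 + f (-Real.cos θ) (Real.sin θ) ^ 2) / 2) := by
      have hc : ∀ a b : Fin (t + 1), Continuous fun θ => c a * c b * g (a + b) θ := fun a b =>
        continuous_const.mul (hg _)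
      have hcongr : ∀ θ, Real.cos θ ^ p * Real.sin θ ^ q *
          ((f (Real.cos θ) (Real.sin θ) ^ 2 + f (-Real.cos θ) (Real.sin θ) ^ 2) / 2) =
          ∑ a : Fin (t + 1), ∑ b : Fin (t + 1), c a * c b * g (a + b) θ := by
        intro θ
        simp only [hf, g]
        rw [← Finset.sum_add_distrib, Finset.sum_div, Finset.mul_sum]
        refine Finset.sum_congr rfl fun a _ => ?_
        rw [← Finset.sum_add_distrib, Finset.sum_div, Finset.mul_sum]
        exact Finset.sum_congr rfl fun b _ => by ring
      simp_rw [hcongr]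
      rw [intervalIntegral.integral_finsetSum fun a _ => Continuous.intervalIntegrable
        (continuous_finsetSum _ fun b _ => hc a b) _ _]
      refine Finset.sum_congr rfl fun a _ => ?_
      rw [intervalIntegral.integral_finsetSum fun b _ => (hc a b).intervalIntegrable _ _]
      simp_rw [intervalIntegral.integral_const_mul]
    rw [hsum]
    have hroot : ∃ x : ℝ, 0 < x ∧ f x 1 ≠ 0 := by
      let P : Polynomial ℝ := ∑ a : Fin (t + 1), Polynomial.monomial (a : ℕ) (c a)
      have hP : P ≠ 0 := by
        obtain ⟨a, ha⟩ := Function.ne_iff.1 hc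
        intro h0
        have := congrArg (fun Q => Polynomial.coeff Q (a : ℕ)) h0
        simp only [P, Polynomial.finsetSum_coeff, Polynomial.coeff_monomial, Fin.val_inj,
          Finset.sum_ite_eq', Finset.mem_univ, if_true, Polynomial.coeff_zero] at this
        exact ha this
      obtain ⟨x, hx, hx'⟩ := (Set.Ioi_infinite (0 : ℝ)).exists_notMem_finset P.roots.toFinset
      refine ⟨x, hx, fun h0 => hx' ?_⟩
      rw [Multiset.mem_toFinset, Polynomial.mem_roots hP, Polynomial.IsRoot, ← h0]
      simp [P, f, Polynomial.eval_finsetSum]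
    obtain ⟨x, hx, hfx⟩ := hroot
    have hhom : ∀ y : ℝ, f (y * x) y = y ^ t * f x 1 := by
      intro y
      simp only [f, Finset.mul_sum]
      refine Finset.sum_congr rfl fun a _ => ?_
      have h0 : y ^ t = y ^ (a : ℕ) * y ^ (t - a) := by
        rw [← pow_add, Nat.add_sub_cancel' (Nat.lt_succ_iff.1 a.2)]
      rw [h0]
      ring
    have h1 : 0 < Real.arctan x := Real.arctan_pos.2 hx
    have h2 := Real.arctan_lt_pi_div_two x
    have hnn : ∀ θ ∈ Set.Icc 0 (Real.pi / 2), 0 ≤ Real.cos θ ∧ 0 ≤ Real.sin θ := fun θ hθ =>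
      ⟨Real.cos_nonneg_of_mem_Icc ⟨by linarith [hθ.1, Real.pi_pos], hθ.2⟩,
        Real.sin_nonneg_of_nonneg_of_le_pi hθ.1 (by linarith [hθ.2, Real.pi_pos])⟩
    -- Strict positivity needs one good angle: at π/2 − arctan x the ratio cos θ / sin θ is `x`,
    -- where the form is nonzero.
    refine intervalIntegral.integral_pos (by positivity) (by fun_prop) (fun θ hθ => ?_)
      ⟨Real.pi / 2 - Real.arctan x, ⟨by linarith, by linarith⟩, ?_⟩
    · obtain ⟨h3, h4⟩ := hnn θ ⟨hθ.1.le, hθ.2⟩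
      positivity
    · have h3 : 0 < Real.cos (Real.arctan x) := Real.cos_arctan_pos x
      have h4 : Real.sin (Real.arctan x) = Real.cos (Real.arctan x) * x := by
        have := Real.tan_arctan x
        rw [Real.tan_eq_sin_div_cos] at this
        field_simp at this
        linarith
      rw [Real.cos_pi_div_two_sub, Real.sin_pi_div_two_sub, h4, hhom]
      positivity

/-! ### Expanding and averaging the t-th power -/

/-- `ζ` stands for η times the conjugate of ξ, written as |ξ|² η ξ⁻¹. It makes the cross term linear
in `u`. -/
theorem exists_inner_mul_eq_inner {K : Type} [NormedDivisionRing K] [InnerProductSpace ℝ K]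
    (ξ η : K) : ∃ ζ : K, ‖ζ‖ ^ 2 = ‖ξ‖ ^ 2 * ‖η‖ ^ 2 ∧ ∀ u : K, ⟪u * ξ, η⟫ = ⟪u, ζ⟫ := by
  rcases eq_or_ne ξ 0 with rfl | hξ
  · exact ⟨0, by simp, by simp⟩
  · refine ⟨(‖ξ‖ ^ 2 : ℝ) • (η * ξ⁻¹), ?_, fun u => ?_⟩
    · have : ‖ξ‖ ≠ 0 := norm_ne_zero_iff.2 hξ
      rw [norm_smul, norm_mul, norm_inv, Real.norm_of_nonneg (by positivity)]
      field_simp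
    · rw [inner_smul_right, ← real_inner_mul_mul_right, inv_mul_cancel_right₀ hξ]

theorem trinomial_expansion (x b y z : ℝ) (t : ℕ) :
    (z ^ 2 * x + 2 * z * b + y) ^ t =
      ∑ j ∈ Finset.range (t + 1), ∑ l ∈ Finset.range (t - j + 1),
        (t.choose j : ℝ) * (t - j).choose l * (2 * b) ^ j * x ^ l * y ^ (t - j - l) *
          z ^ (j + 2 * l) := by
  rw [show z ^ 2 * x + 2 * z * b + y = 2 * z * b + (z ^ 2 * x + y) by ring, add_pow]
  refine Finset.sum_congr rfl fun j _ => ?_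
  rw [add_pow, Finset.mul_sum, Finset.sum_mul]
  refine Finset.sum_congr rfl fun l _ => ?_
  ring

/-- Only the even moments contribute to the trinomial expansion. -/
theorem sum_weight_mul_trinomial {ι : Type*} [Fintype ι] (μ z : ι → ℝ) {t : ℕ}
    (hodd : ∀ j ≤ 2 * t, Odd j → ∑ i, μ i * z i ^ j = 0) (x b y : ℝ) :
    ∑ i, μ i * (z i ^ 2 * x + 2 * z i * b + y) ^ t =
      ∑ r ∈ Finset.range (t + 1), ∑ i ∈ Finset.range (min r (t - r) + 1),
        (∑ k, μ k * z k ^ (2 * r)) * ((t.choose (2 * i) : ℝ) * (t - 2 * i).choose (r - i) * 4 ^ i *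
          (b ^ 2) ^ i * x ^ (r - i) * y ^ (t - r - i)) := by
  have h1 : ∑ i, μ i * (z i ^ 2 * x + 2 * z i * b + y) ^ t =
      ∑ j ∈ Finset.range (t + 1), ∑ l ∈ Finset.range (t - j + 1),
        (∑ k, μ k * z k ^ (j + 2 * l)) *
          ((t.choose j : ℝ) * (t - j).choose l * (2 * b) ^ j * x ^ l * y ^ (t - j - l)) := by
    simp_rw [trinomial_expansion, Finset.mul_sum]
    rw [Finset.sum_comm]
    refine Finset.sum_congr rfl fun j _ => ?_
    rw [Finset.sum_comm]
    refine Finset.sum_congr rfl fun l _ => ?_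
    rw [Finset.sum_mul]
    exact Finset.sum_congr rfl fun k _ => by ring
  rw [h1, Finset.sum_sigma', Finset.sum_sigma']
  rw [← Finset.sum_filter_of_ne (p := fun p : (_ : ℕ) × ℕ => Even p.1)]
  -- With the power of the cross term equal to 2i, set r = i + l, half the exponent of `z`.
  · refine Finset.sum_nbij' (fun p => ⟨p.1 / 2 + p.2, p.1 / 2⟩)
      (fun p => ⟨2 * p.2, p.1 - p.2⟩) ?_ ?_ ?_ ?_ ?_
    · rintro ⟨j, l⟩ h
      simp only [Finset.mem_filter, Finset.mem_sigma, Finset.mem_range] at h ⊢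
      omega
    · rintro ⟨r, i⟩ h
      simp only [Finset.mem_filter, Finset.mem_sigma, Finset.mem_range] at h ⊢
      exact ⟨by omega, even_two_mul i⟩
    · rintro ⟨j, l⟩ h
      simp only [Finset.mem_filter] at h
      rw [Nat.add_sub_cancel_left, Nat.two_mul_div_two_of_even h.2]
    · rintro ⟨r, i⟩ h
      simp only [Finset.mem_sigma, Finset.mem_range] at h
      simp only [Nat.mul_div_cancel_left i two_pos]
      rw [Nat.add_sub_cancel' (by omega)]
    · rintro ⟨j, l⟩ h
      simp only [Finset.mem_filter] at h
      obtain ⟨i, rfl⟩ := even_iff_two_dvd.1 h.2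
      simp only [Nat.mul_div_cancel_left i two_pos, Nat.add_sub_cancel_left]
      rw [show t - 2 * i - l = t - (i + l) - i by omega, mul_add, pow_mul (2 * b), mul_pow]
      ring
  · rintro ⟨j, l⟩ h hne
    simp only [Finset.mem_sigma, Finset.mem_range] at h
    by_contra hj
    rw [Nat.not_even_iff_odd] at hj
    refine hne ?_
    dsimp only
    rw [hodd (j + 2 * l) (by omega) (hj.add_even (even_two_mul l)), zero_mul]

theorem choose_two_mul_mul_choose_mul_risingFactorial_half {t r i : ℕ} (hr : r ≤ t) (hi : i ≤ r)
    (hi' : i ≤ t - r) :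
    (t.choose (2 * i) : ℝ) * (t - 2 * i).choose (r - i) * 4 ^ i * risingFactorial (1 / 2) i =
      t.choose r * (r.choose i * (t - r).descFactorial i) := by
  have h1 := four_pow_mul_risingFactorial_half i
  have h2 : ((t - r - i).factorial : ℝ) * (t - r).descFactorial i = (t - r).factorial := by
    exact_mod_cast Nat.factorial_mul_descFactorial hi'
  rw [Nat.cast_choose ℝ (by omega : 2 * i ≤ t), Nat.cast_choose ℝ (by omega : r - i ≤ t - 2 * i),
    Nat.cast_choose ℝ hr, Nat.cast_choose ℝ hi, ← h1, ← h2,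
    show t - 2 * i - (r - i) = t - r - i by omega]
  have h3 := (risingFactorial_pos (a := 1 / 2) (by norm_num) i).ne'
  have h4 : ∀ n : ℕ, (n.factorial : ℝ) ≠ 0 := fun n => by positivity
  have h5 := h4 i
  have h6 := h4 r
  have h7 := h4 (r - i)
  have h8 := h4 (t - 2 * i)
  have h9 := h4 (t - r - i)
  have h10 : ((t - r).descFactorial i : ℝ) ≠ 0 := fun h0 => h4 (t - r) (by rw [← h2, h0, mul_zero])
  field_simp

/-- Since 4^i (1/2)_i = (2i)!/i!, the summands become those of Chu–Vandermonde. -/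
theorem sum_choose_mul_choose_mul_risingFactorial {t r : ℕ} (hr : r ≤ t) {a : ℝ} (ha : 0 < a) :
    ∑ i ∈ Finset.range (min r (t - r) + 1), (t.choose (2 * i) : ℝ) * (t - 2 * i).choose (r - i) *
      4 ^ i * (risingFactorial (1 / 2) i / risingFactorial a i) =
      t.choose r * (risingFactorial a t / (risingFactorial a r * risingFactorial a (t - r))) := by
  have h1 : ∀ i ∈ Finset.range (min r (t - r) + 1),
      (t.choose (2 * i) : ℝ) * (t - 2 * i).choose (r - i) *
        4 ^ i * (risingFactorial (1 / 2) i / risingFactorial a i) =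
      t.choose r / risingFactorial a r * ((r.choose i : ℝ) * (t - r).descFactorial i *
        risingFactorial (a + i) (r - i)) := by
    intro i hi
    rw [Finset.mem_range] at hi
    have h2 := risingFactorial_add a i (r - i)
    rw [Nat.add_sub_cancel' (by omega)] at h2
    have h3 := (risingFactorial_pos ha i).ne'
    have h4 := (risingFactorial_pos ha r).ne'
    rw [← mul_div_assoc,
      choose_two_mul_mul_choose_mul_risingFactorial_half hr (by omega) (by omega)]
    rw [h2] at h4 ⊢
    have h5 := right_ne_zero_of_mul h4
    field_simp
  rw [Finset.sum_congr rfl h1, ← Finset.mul_sum]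
  have h2 : ∑ i ∈ Finset.range (min r (t - r) + 1), (r.choose i : ℝ) * (t - r).descFactorial i *
      risingFactorial (a + i) (r - i) = risingFactorial (a + (t - r : ℕ)) r := by
    rw [← sum_choose_mul_descFactorial_mul_risingFactorial]
    refine Finset.sum_subset (Finset.range_subset_range.2 (by omega)) fun i hi hi' => ?_
    rw [Finset.mem_range] at hi hi'
    rw [Nat.descFactorial_of_lt (by omega)]
    simp
  have h3 := risingFactorial_add a (t - r) r
  rw [Nat.sub_add_cancel hr] at h3
  have h4 := (risingFactorial_pos ha r).ne'
  have h5 := (risingFactorial_pos ha (t - r)).ne'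
  rw [h2, h3]
  field_simp

/-! ### The step from m to m + 1 -/

section Recursion

variable {K : Type} [NormedDivisionRing K] [InnerProductSpace ℝ K] [IsScalarTower ℝ K K]

/-- Averaging `‖z * u * ξ + η‖ ^ (2 * t)` over the nodes `z` and the unit vectors `u`. -/
theorem sum_sum_weight_mul_norm_pow {ι κ : Type*} [Fintype ι] [Fintype κ] (μ z : ι → ℝ)
    (w : κ → ℝ) (u : κ → K) {t : ℕ} {a A : ℝ} (ha : 0 < a)
    (hodd : ∀ j ≤ 2 * t, Odd j → ∑ i, μ i * z i ^ j = 0) (hu : ∀ k, ‖u k‖ = 1)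
    (hw : ∀ j ≤ t / 2, ∀ x : K, ∑ k, w k * (⟪u k, x⟫ ^ 2) ^ j =
        A * (risingFactorial (1 / 2) j / risingFactorial a j) * (‖x‖ ^ 2) ^ j) (ξ η : K) :
    ∑ k, w k * ∑ i, μ i * (‖z i • u k * ξ + η‖ ^ 2) ^ t =
      ∑ r ∈ Finset.range (t + 1), A * (t.choose r * (risingFactorial a t /
        (risingFactorial a r * risingFactorial a (t - r)))) * (∑ i, μ i * z i ^ (2 * r)) *
          (‖ξ‖ ^ 2) ^ r * (‖η‖ ^ 2) ^ (t - r) := by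
  obtain ⟨ζ, hζ, hζ'⟩ := exists_inner_mul_eq_inner ξ η
  have hnorm : ∀ k i, ‖z i • u k * ξ + η‖ ^ 2 =
      z i ^ 2 * ‖ξ‖ ^ 2 + 2 * z i * ⟪u k, ζ⟫ + ‖η‖ ^ 2 := by
    intro k i
    rw [norm_add_sq_real, smul_mul_assoc, inner_smul_left, hζ', norm_smul, norm_mul, hu, mul_pow,
      Real.norm_eq_abs, sq_abs]
    simp
    ring
  have htri := fun b => sum_weight_mul_trinomial μ z hodd (‖ξ‖ ^ 2) b (‖η‖ ^ 2)
  generalize hm : (fun r : ℕ => ∑ i, μ i * z i ^ (2 * r)) = m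
  have hm' : ∀ r, ∑ i, μ i * z i ^ (2 * r) = m r := fun r => congrFun hm r
  simp_rw [hm'] at htri ⊢
  simp_rw [hnorm, htri, Finset.mul_sum]
  rw [Finset.sum_comm]
  refine Finset.sum_congr rfl fun r hr => ?_
  rw [Finset.mem_range] at hr
  rw [Finset.sum_comm, ← sum_choose_mul_choose_mul_risingFactorial (by omega) ha]
  simp_rw [Finset.mul_sum, Finset.sum_mul]
  refine Finset.sum_congr rfl fun i hi => ?_
  rw [Finset.mem_range] at hi
  have h1 := hw i (by omega) ζ
  have h2 : ∀ x : ℝ, x ^ r = x ^ i * x ^ (r - i) := fun x => by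
    rw [← pow_add, Nat.add_sub_cancel' (by omega)]
  have h3 : ∀ x : ℝ, x ^ (t - r) = x ^ i * x ^ (t - r - i) := fun x => by
    rw [← pow_add, Nat.add_sub_cancel' (by omega)]
  rw [h2, h3]
  have h4 : ∑ k, w k * (m r * ((t.choose (2 * i) : ℝ) * (t - 2 * i).choose (r - i) * 4 ^ i *
      (⟪u k, ζ⟫ ^ 2) ^ i * (‖ξ‖ ^ 2) ^ (r - i) * (‖η‖ ^ 2) ^ (t - r - i))) =
      m r * ((t.choose (2 * i) : ℝ) * (t - 2 * i).choose (r - i) * 4 ^ i *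
        (‖ξ‖ ^ 2) ^ (r - i) * (‖η‖ ^ 2) ^ (t - r - i)) * ∑ k, w k * (⟪u k, ζ⟫ ^ 2) ^ i := by
    rw [Finset.mul_sum]
    exact Finset.sum_congr rfl fun k _ => by ring
  rw [h4, h1, hζ, mul_pow]
  ring

theorem succ_mem_embeddingDims [SMulCommClass ℝ K K] [FiniteDimensional ℝ K]
    {δ m t N n : ℕ} (hδ : Module.finrank ℝ K = δ) (hm : 0 < m) (ht : 2 ≤ t)
    (hN : N ∈ embeddingDims ℝ δ (2 * (t / 2))) (hn : n ∈ embeddingDims K m (2 * t)) :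
    t * (N * n) + 1 ∈ embeddingDims K (m + 1) (2 * t) := by
  have hδ0 : 0 < δ := hδ ▸ Module.finrank_pos
  -- The exponents are chosen so that the Beta parameters are δ/2 and δm/2.
  obtain ⟨p, hp⟩ : ∃ p, p + 1 = δ := ⟨δ - 1, by omega⟩
  obtain ⟨q, hq⟩ : ∃ q, q + 1 = δ * m := ⟨δ * m - 1, Nat.sub_add_cancel (Nat.mul_pos hδ0 hm)⟩
  have ha : (0 : ℝ) < ((p + 1 : ℕ) : ℝ) / 2 := by positivity
  have hb : (0 : ℝ) < ((q + 1 : ℕ) : ℝ) / 2 := by positivity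
  obtain ⟨w, u, A, hw, hu, hA, hwu⟩ := exists_unit_weights (a := ((p + 1 : ℕ) : ℝ) / 2) hδ
    (by omega : 0 < t / 2) hN (by rw [hp])
  obtain ⟨c, hc⟩ := (embeddingDims_iff (by omega)).1 hn
  obtain ⟨w', v, A', hw', -, hA', hwv⟩ := exists_normalized_weights (a := ((p + 1 : ℕ) : ℝ) / 2)
    (b := ((q + 1 : ℕ) : ℝ) / 2) hm (by omega : 0 < t) c hc (by rw [hp, hδ])
    (by rw [hq, hδ]; push_cast; ring)
  obtain ⟨M, B, hB, hM, hM', hMpos⟩ := exists_moments p q t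
  obtain ⟨z, μ, s, hμ, hs, hquad⟩ := exists_quadrature (by omega : 0 < t) M hMpos
  generalize ((p + 1 : ℕ) : ℝ) / 2 = a at *
  generalize ((q + 1 : ℕ) : ℝ) / 2 = b at *
  have hodd : ∀ j ≤ 2 * t, Odd j → ∑ i, μ i * z i ^ j = 0 := by
    intro j hj hj'
    have hne : j ≠ 2 * t := fun h => Nat.not_even_iff_odd.2 hj' (h ▸ even_two_mul t)
    have := hquad j hj
    rwa [if_neg hne, add_zero, hM j hj'] at this
  have heven : ∀ r ≤ t, ∑ i, μ i * z i ^ (2 * r) =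
      B * (risingFactorial a r * risingFactorial b (t - r)) - if r = t then s else 0 := by
    intro r hr
    rw [← hM' r hr, ← hquad (2 * r) (by omega)]
    simp
  have hcard : Fintype.card (Option (Fin t × Fin N × Fin n)) = t * (N * n) + 1 := by simp
  rw [← hcard]
  have hta := risingFactorial_pos ha t
  -- `none` indexes the node at infinity, with vector (1, 0) and weight proportional to the defect
  -- `s`.
  refine card_mem_embeddingDims (by omega)
    (fun o => o.elim (s * A * A') fun k => μ k.1 * w k.2.1 * w' k.2.2)
    ?_ (fun o => o.elim (Fin.cons 1 0) fun k => Fin.cons (z k.1 • u k.2.1) (v k.2.2))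
    (A := A * A' * B * risingFactorial a t) (by positivity) fun y => ?_
  · rintro (_ | ⟨i, k, l⟩)
    · exact mul_nonneg (mul_nonneg hs hA.le) hA'.le
    · exact mul_nonneg (mul_nonneg (hμ i) (hw k)) (hw' l)
  · rw [Fintype.sum_option]
    simp only [Option.elim, Fin.sum_univ_succ, Fin.cons_zero, Fin.cons_succ, Pi.zero_apply,
      zero_mul, one_mul, Finset.sum_const_zero, add_zero]
    have h1 : ∑ x : Fin t × Fin N × Fin n, μ x.1 * w x.2.1 * w' x.2.2 *
        (‖z x.1 • u x.2.1 * y 0 + ∑ i, v x.2.2 i * y i.succ‖ ^ 2) ^ t =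
        ∑ l, w' l * ∑ k, w k * ∑ i, μ i *
          (‖z i • u k * y 0 + ∑ j, v l j * y j.succ‖ ^ 2) ^ t := by
      simp_rw [Fintype.sum_prod_type, Finset.mul_sum]
      rw [Finset.sum_comm]
      simp_rw [fun k => Finset.sum_comm (s := (Finset.univ : Finset (Fin t)))
        (t := (Finset.univ : Finset (Fin n))) (f := fun i l => μ i * w k * w' l *
          (‖z i • u k * y 0 + ∑ j, v l j * y j.succ‖ ^ 2) ^ t)]
      rw [Finset.sum_comm]
      exact Finset.sum_congr rfl fun _ _ => Finset.sum_congr rfl fun _ _ =>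
        Finset.sum_congr rfl fun _ _ => by ring
    rw [h1]
    simp_rw [sum_sum_weight_mul_norm_pow μ z w u ha hodd hu hwu, Finset.mul_sum (Finset.range _)]
    rw [Finset.sum_comm]
    -- All rising factorials except (a)_t cancel, leaving binomial terms; the `r = t` correction
    -- cancels against the node at infinity.
    have h2 : ∀ r ∈ Finset.range (t + 1), ∑ l, w' l * (A * (t.choose r * (risingFactorial a t /
        (risingFactorial a r * risingFactorial a (t - r)))) * (∑ i, μ i * z i ^ (2 * r)) *
          (‖y 0‖ ^ 2) ^ r * (‖∑ j, v l j * y j.succ‖ ^ 2) ^ (t - r)) =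
        A * A' * B * risingFactorial a t * ((‖y 0‖ ^ 2) ^ r *
          (∑ j : Fin m, ‖y j.succ‖ ^ 2) ^ (t - r) * t.choose r) -
          if r = t then s * A * A' * (‖y 0‖ ^ 2) ^ t else 0 := by
      intro r hr
      rw [Finset.mem_range] at hr
      have h3 : ∀ C D : ℝ, ∑ l, w' l * (C * D * (‖∑ j, v l j * y j.succ‖ ^ 2) ^ (t - r)) =
          C * D * ∑ l, w' l * (‖∑ j, v l j * y j.succ‖ ^ 2) ^ (t - r) := by
        intro C D
        rw [Finset.mul_sum]
        exact Finset.sum_congr rfl fun _ _ => by ring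
      have h4 := (risingFactorial_pos ha r).ne'
      have h5 := (risingFactorial_pos ha (t - r)).ne'
      have h6 := (risingFactorial_pos hb (t - r)).ne'
      rw [h3, hwv (t - r) (by omega) fun j => y j.succ, heven r (by omega)]
      split_ifs with hrt
      · subst hrt
        simp only [Nat.sub_self, risingFactorial_zero, pow_zero, Nat.choose_self, Nat.cast_one]
        field_simp
      · field_simp
        ring
    rw [Finset.sum_congr rfl h2, Finset.sum_sub_distrib, ← Finset.mul_sum, ← add_pow]
    simp

end Recursion

/-! ### Existence and the two bounds -/

section Bounds

variable {K : Type} [NormedDivisionRing K] [InnerProductSpace ℝ K] [SMulCommClass ℝ K K]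
  [IsScalarTower ℝ K K] [FiniteDimensional ℝ K]

theorem embeddingDims_nonempty_of_real {δ m t : ℕ} (hδ : Module.finrank ℝ K = δ) (hm : 1 ≤ m)
    (ht : 1 ≤ t) (hreal : 2 ≤ t → (embeddingDims ℝ δ (2 * (t / 2))).Nonempty) :
    (embeddingDims K m (2 * t)).Nonempty := by
  rcases ht.eq_or_lt with rfl | ht
  · exact ⟨m, self_mem_embeddingDims⟩
  · obtain ⟨N, hN⟩ := hreal ht
    induction m, hm using Nat.le_induction with
    | base => exact ⟨1, one_mem_embeddingDims (by omega)⟩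
    | succ m hm ih =>
      obtain ⟨n, hn⟩ := ih
      exact ⟨_, succ_mem_embeddingDims hδ hm ht hN hn⟩

/-- There is no circularity: over ℝ the recursion only needs the one-dimensional real system, which
is trivial. This then supplies the auxiliary real system for every K. -/
theorem embeddingDims_real_nonempty {m t : ℕ} (hm : 1 ≤ m) (ht : 1 ≤ t) :
    (embeddingDims ℝ m (2 * t)).Nonempty :=
  embeddingDims_nonempty_of_real (Module.finrank_self ℝ) hm ht fun ht' =>
    ⟨1, one_mem_embeddingDims (by omega)⟩

theorem embeddingDims_nonempty {m t : ℕ} (hm : 1 ≤ m) (ht : 1 ≤ t) :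
    (embeddingDims K m (2 * t)).Nonempty :=
  embeddingDims_nonempty_of_real rfl hm ht fun ht' =>
    embeddingDims_real_nonempty Module.finrank_pos (by omega)

theorem minDim_le {δ m t : ℕ} (hδ : Module.finrank ℝ K = δ) (hm : 2 ≤ m) (ht : 2 ≤ t) :
    minDim K m (2 * t) ≤ t * (minDim ℝ δ (2 * (t / 2)) * minDim K (m - 1) (2 * t)) + 1 := by
  have hδ0 : 1 ≤ δ := hδ ▸ Module.finrank_pos
  obtain ⟨m, rfl⟩ : ∃ k, m = k + 1 := ⟨m - 1, by omega⟩
  rw [Nat.add_sub_cancel]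
  exact Nat.sInf_le (succ_mem_embeddingDims hδ (by omega) ht
    (Nat.sInf_mem (embeddingDims_real_nonempty hδ0 (by omega)))
    (Nat.sInf_mem (embeddingDims_nonempty (by omega) (by omega))))

theorem minDim_pos {m t : ℕ} (hm : 1 ≤ m) (ht : 1 ≤ t) : 1 ≤ minDim K m (2 * t) :=
  pos_of_mem_embeddingDims ht hm (Nat.sInf_mem (embeddingDims_nonempty hm ht))

/-- For odd `t = p/2`, 2⌊t/2⌋ = p/2 − 1 and the extra 1 is bounded by N·n; for even `t`, 2⌊t/2⌋ =
p/2 and it is bounded by N. -/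
theorem minDim_recursive_bounds {δ m p : ℕ} (hδ : Module.finrank ℝ K = δ) (hm : 2 ≤ m)
    (hp : 4 ≤ p) :
    (p % 4 = 2 →
      minDim K m p ≤ minDim ℝ δ (p / 2 - 1) * (p / 2 + 1) * minDim K (m - 1) p) ∧
    (p % 4 = 0 →
      minDim K m p ≤ minDim ℝ δ (p / 2) * (p / 2 * minDim K (m - 1) p + 1)) := by
  have hδ0 : 1 ≤ δ := hδ ▸ Module.finrank_pos
  constructor
  · intro h
    obtain ⟨t, rfl⟩ : ∃ t, p = 2 * t := ⟨p / 2, by omega⟩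
    have h1 := minDim_le (K := K) hδ hm (by omega : 2 ≤ t)
    have h2 : 1 ≤ minDim ℝ δ (2 * (t / 2)) := minDim_pos hδ0 (by omega)
    have h3 : 1 ≤ minDim K (m - 1) (2 * t) := minDim_pos (by omega) (by omega)
    rw [show 2 * t / 2 - 1 = 2 * (t / 2) by omega, show 2 * t / 2 = t by omega]
    have h4 := Nat.mul_le_mul h2 h3
    calc _ ≤ _ := h1
      _ ≤ t * (minDim ℝ δ (2 * (t / 2)) * minDim K (m - 1) (2 * t)) +
          minDim ℝ δ (2 * (t / 2)) * minDim K (m - 1) (2 * t) := Nat.add_le_add_left h4 _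
      _ = _ := by ring
  · intro h
    obtain ⟨t, rfl⟩ : ∃ t, p = 2 * t := ⟨p / 2, by omega⟩
    have h1 := minDim_le (K := K) hδ hm (by omega : 2 ≤ t)
    have h2 : 1 ≤ minDim ℝ δ (2 * (t / 2)) := minDim_pos hδ0 (by omega)
    rw [show 2 * t / 2 = t by omega]
    rw [show 2 * (t / 2) = t by omega] at h1 h2
    calc _ ≤ _ := h1
      _ ≤ t * (minDim ℝ δ t * minDim K (m - 1) (2 * t)) + minDim ℝ δ t :=
        Nat.add_le_add_left h2 _
      _ = _ := by ring

end Bounds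

theorem corollary1p5 :
    -- the minimal numbers are minima of nonempty sets
    (∀ m p : ℕ, 1 ≤ m → 2 ≤ p → Even p →
      (embeddingDims ℝ m p).Nonempty ∧ (embeddingDims ℂ m p).Nonempty ∧
        (embeddingDims (Quaternion ℝ) m p).Nonempty) ∧
    -- the recursive bounds over the reals, the complex numbers and the quaternions
    (∀ m p : ℕ, 2 ≤ m → 4 ≤ p →
      ((p % 4 = 2 → minDim ℝ m p ≤
          minDim ℝ 1 (p / 2 - 1) * (p / 2 + 1) * minDim ℝ (m - 1) p) ∧
        (p % 4 = 0 → minDim ℝ m p ≤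
          minDim ℝ 1 (p / 2) * (p / 2 * minDim ℝ (m - 1) p + 1))) ∧
      ((p % 4 = 2 → minDim ℂ m p ≤
          minDim ℝ 2 (p / 2 - 1) * (p / 2 + 1) * minDim ℂ (m - 1) p) ∧
        (p % 4 = 0 → minDim ℂ m p ≤
          minDim ℝ 2 (p / 2) * (p / 2 * minDim ℂ (m - 1) p + 1))) ∧
      ((p % 4 = 2 → minDim (Quaternion ℝ) m p ≤
          minDim ℝ 4 (p / 2 - 1) * (p / 2 + 1) * minDim (Quaternion ℝ) (m - 1) p) ∧
        (p % 4 = 0 → minDim (Quaternion ℝ) m p ≤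
          minDim ℝ 4 (p / 2) * (p / 2 * minDim (Quaternion ℝ) (m - 1) p + 1)))) := by
  refine ⟨fun m p hm hp hev => ?_, fun m p hm hp =>
    ⟨minDim_recursive_bounds (Module.finrank_self ℝ) hm hp,
      minDim_recursive_bounds Complex.finrank_real_complex hm hp,
      minDim_recursive_bounds Quaternion.finrank_eq_four hm hp⟩⟩
  obtain ⟨t, rfl⟩ := hev.two_dvd
  exact ⟨embeddingDims_nonempty hm (by omega), embeddingDims_nonempty hm (by omega),
    embeddingDims_nonempty hm (by omega)⟩
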